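/- Let $m\ge 0$, let $H$ be a group with subgroups $H_1,\dots,H_m$, and let $N$ be a normal subgroup of $H$ such that $N\cap H_i$ is trivial for each $i$. For each $i$ let $G_i$ be a group containing $H_i$ as a subgroup. Let $G$ be the fundamental group of the star-shaped graph of groups with $m$ arms of length one, whose central vertex group is $H$, whose edge groups are $H_1,\dots,H_m$ and whose outer vertex groups are $G_1,\dots,G_m$, the edge homomorphisms being the inclusions $H_i\to H$ and $H_i\to G_i$. Let $\overline{G}$ be the fundamental group of the graph of groups obtained by replacing the central vertex group by $\overline{H}=H/N$ and the inclusions $H_i\to H$ by the (injective) composites $H_i\to H\to H/N$. Then the quotient map $H\to H/N$, together with the identity maps on the edge groups and on the outer vertex groups, induces a surjective group homomorphism $G\to\overline{G}$, and the kernel of this homomorphism is isomorphic to a free product of copies of $N$ indexed by the set $\overline{G}/\overline{H}$ of cosets in $\overline{G}$ of the image of the vertex group $\overline{H}$. -/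

import Mathlib

universe u v w

/-- A graph (loops and multiple edges allowed), each edge with a chosen orientation
from `src e` to `tgt e`. -/
structure OrientedGraph (V : Type v) (E : Type w) where
  src : E → V
  tgt : E → V

namespace OrientedGraph

variable {V : Type v} {E : Type w}

/-- The simple graph on `V` spanned by a set `T` of edges (orientations, loops and multiplicities
being forgotten). -/
def edgesGraph (Γ : OrientedGraph V E) (T : Set E) : SimpleGraph V :=
  SimpleGraph.fromRel (fun x y => ∃ e ∈ T, Γ.src e = x ∧ Γ.tgt e = y)

/-- A spanning (= maximal) tree of a graph: a set of edges without loops and without multiple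
edges which, together with all the vertices, forms a tree. -/
structure SpanningTree (Γ : OrientedGraph V E) where
  edges : Set E
  no_loop : ∀ e ∈ edges, Γ.src e ≠ Γ.tgt e
  no_multiple : ∀ e ∈ edges, ∀ e' ∈ edges, s(Γ.src e, Γ.tgt e) = s(Γ.src e', Γ.tgt e') → e = e'
  isTree : (Γ.edgesGraph edges).IsTree

/-- The star-shaped graph with arms of length one indexed by `ι`: the centre is `none`, the outer
vertices are `some i`, and the edge `i` runs from the centre to `some i`. -/
def star (ι : Type w) : OrientedGraph (Option ι) ι where
  src _ := none
  tgt i := some i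

theorem star_edgesGraph_univ (ι : Type w) :
    (star ι).edgesGraph Set.univ = SimpleGraph.starGraph (none : Option ι) := by
  ext x y
  rw [SimpleGraph.starGraph_adj]
  rcases x with _ | x <;> rcases y with _ | y <;>
    simp [edgesGraph, star, SimpleGraph.fromRel_adj]

/-- The star is a tree, so all of its edges together form its spanning tree. -/
def starSpanningTree (ι : Type w) : (star ι).SpanningTree where
  edges := Set.univ
  no_loop _ _ := by simp [star]
  no_multiple _ _ _ _ h := by simpa [star] using h
  isTree := by
    rw [star_edgesGraph_univ]
    exact SimpleGraph.isTree_starGraph _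

end OrientedGraph

/-- A graph of groups over the graph `Γ`: vertex groups, edge groups, and injective homomorphisms
from each edge group to the vertex groups at the two ends of the edge. -/
structure GraphOfGroups {V : Type v} {E : Type w} (Γ : OrientedGraph V E) where
  vertexGroup : V → Type u
  edgeGroup : E → Type u
  [vertexGroup_group : ∀ x, Group (vertexGroup x)]
  [edgeGroup_group : ∀ e, Group (edgeGroup e)]
  toSrc : ∀ e, edgeGroup e →* vertexGroup (Γ.src e)
  toTgt : ∀ e, edgeGroup e →* vertexGroup (Γ.tgt e)
  toSrc_injective : ∀ e, Function.Injective (toSrc e)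
  toTgt_injective : ∀ e, Function.Injective (toTgt e)

attribute [instance] GraphOfGroups.vertexGroup_group GraphOfGroups.edgeGroup_group

namespace GraphOfGroups

variable {V : Type v} {E : Type w} {Γ : OrientedGraph V E}

/-- The free product of all the vertex groups and of the free group on the edges. -/
abbrev FreeProd (𝒢 : GraphOfGroups.{u} Γ) : Type _ :=
  Monoid.Coprod (Monoid.CoprodI 𝒢.vertexGroup) (FreeGroup E)

/-- The vertex group at `x` inside the free product. -/
def vertexIn (𝒢 : GraphOfGroups.{u} Γ) (x : V) : 𝒢.vertexGroup x →* 𝒢.FreeProd :=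
  Monoid.Coprod.inl.comp (Monoid.CoprodI.of (i := x))

/-- The edge letter `t_e` inside the free product. -/
def edgeIn (𝒢 : GraphOfGroups.{u} Γ) (e : E) : 𝒢.FreeProd :=
  Monoid.Coprod.inr (FreeGroup.of e)

/-- The defining relators of the fundamental group with respect to a spanning tree `T`:
`t_e * toTgt a * t_e⁻¹ = toSrc a` for each edge `e` and each `a` in the edge group at `e`, and
`t_e = 1` for each edge `e` of `T`. -/
def relators (𝒢 : GraphOfGroups.{u} Γ) (T : Γ.SpanningTree) : Set 𝒢.FreeProd :=
  {r | ∃ (e : E) (a : 𝒢.edgeGroup e),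
      r = 𝒢.edgeIn e * 𝒢.vertexIn _ (𝒢.toTgt e a) * (𝒢.edgeIn e)⁻¹ *
        (𝒢.vertexIn _ (𝒢.toSrc e a))⁻¹} ∪
  {r | ∃ e ∈ T.edges, r = 𝒢.edgeIn e}

/-- The fundamental group of a graph of groups (with respect to a spanning tree `T`). -/
abbrev FundamentalGroup (𝒢 : GraphOfGroups.{u} Γ) (T : Γ.SpanningTree) : Type _ :=
  𝒢.FreeProd ⧸ Subgroup.normalClosure (𝒢.relators T)

/-- The canonical homomorphism from a vertex group to the fundamental group. -/
def ofVertex (𝒢 : GraphOfGroups.{u} Γ) (T : Γ.SpanningTree) (x : V) :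
    𝒢.vertexGroup x →* 𝒢.FundamentalGroup T :=
  (QuotientGroup.mk' _).comp (𝒢.vertexIn x)

/-- The element of the fundamental group given by an edge. -/
def ofEdge (𝒢 : GraphOfGroups.{u} Γ) (T : Γ.SpanningTree) (e : E) : 𝒢.FundamentalGroup T :=
  QuotientGroup.mk' _ (𝒢.edgeIn e)

/-- A morphism of graphs of groups over the identity of `Γ`: homomorphisms of the vertex groups
and of the edge groups, compatible with the structure maps. -/
structure Hom (𝒢 𝒢' : GraphOfGroups.{u} Γ) where
  onVertex : ∀ x, 𝒢.vertexGroup x →* 𝒢'.vertexGroup x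
  onEdge : ∀ e, 𝒢.edgeGroup e →* 𝒢'.edgeGroup e
  comm_src : ∀ e a, onVertex _ (𝒢.toSrc e a) = 𝒢'.toSrc e (onEdge e a)
  comm_tgt : ∀ e a, onVertex _ (𝒢.toTgt e a) = 𝒢'.toTgt e (onEdge e a)

namespace Hom

variable {𝒢 𝒢' : GraphOfGroups.{u} Γ}

/-- The homomorphism of free products that is `onVertex x` on the vertex group at `x` and
fixes the edge letters. -/
def freeProdMap (f : Hom 𝒢 𝒢') : 𝒢.FreeProd →* 𝒢'.FreeProd :=
  Monoid.Coprod.map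
    (Monoid.CoprodI.lift fun x => (Monoid.CoprodI.of (i := x)).comp (f.onVertex x))
    (MonoidHom.id _)

@[simp] theorem freeProdMap_vertexIn (f : Hom 𝒢 𝒢') (x : V) (g : 𝒢.vertexGroup x) :
    f.freeProdMap (𝒢.vertexIn x g) = 𝒢'.vertexIn x (f.onVertex x g) := by
  simp [freeProdMap, vertexIn]

@[simp] theorem freeProdMap_edgeIn (f : Hom 𝒢 𝒢') (e : E) :
    f.freeProdMap (𝒢.edgeIn e) = 𝒢'.edgeIn e := by
  simp [freeProdMap, edgeIn]

theorem normalClosure_le_comap (f : Hom 𝒢 𝒢') (T : Γ.SpanningTree) :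
    Subgroup.normalClosure (𝒢.relators T) ≤
      (Subgroup.normalClosure (𝒢'.relators T)).comap f.freeProdMap := by
  refine Subgroup.normalClosure_le_normal ?_
  rintro r (⟨e, a, rfl⟩ | ⟨e, he, rfl⟩)
  · refine Subgroup.subset_normalClosure (Or.inl ⟨e, f.onEdge e a, ?_⟩)
    simp [f.comm_src, f.comm_tgt]
  · exact Subgroup.subset_normalClosure (Or.inr ⟨e, he, by simp⟩)

/-- The homomorphism of fundamental groups induced by a morphism of graphs of groups. -/
def map (f : Hom 𝒢 𝒢') (T : Γ.SpanningTree) :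
    𝒢.FundamentalGroup T →* 𝒢'.FundamentalGroup T :=
  QuotientGroup.map _ _ f.freeProdMap (f.normalClosure_le_comap T)

@[simp] theorem map_ofVertex (f : Hom 𝒢 𝒢') (T : Γ.SpanningTree) (x : V)
    (g : 𝒢.vertexGroup x) :
    f.map T (𝒢.ofVertex T x g) = 𝒢'.ofVertex T x (f.onVertex x g) := by
  simp [map, ofVertex]

@[simp] theorem map_ofEdge (f : Hom 𝒢 𝒢') (T : Γ.SpanningTree) (e : E) :
    f.map T (𝒢.ofEdge T e) = 𝒢'.ofEdge T e := by
  simp [map, ofEdge]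

end Hom

section Star

variable {ι : Type w} {H : Type u} [Group H] {L : ι → Type u} [∀ i, Group (L i)]
  {A : ι → Type u} [∀ i, Group (A i)]

/-- The vertex groups of a star: `H` at the centre, `L i` at the `i`-th outer vertex. -/
abbrev StarVertexGroup (H : Type u) (L : ι → Type u) : Option ι → Type u
  | none => H
  | some i => L i

/-- The group structures on the vertex groups of a star. -/
@[reducible] def starVertexGroupGroup (H : Type u) [Group H] (L : ι → Type u)
    [∀ i, Group (L i)] : ∀ x, Group (StarVertexGroup H L x)
  | none => inferInstanceAs (Group H)
  | some i => inferInstanceAs (Group (L i))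

/-- The star-shaped graph of groups with centre `H`, edge groups `A i` and outer vertex groups
`L i`, for injective homomorphisms `φ i : A i → H` and `ψ i : A i → L i`. -/
def star (φ : ∀ i, A i →* H) (ψ : ∀ i, A i →* L i) (hφ : ∀ i, Function.Injective (φ i))
    (hψ : ∀ i, Function.Injective (ψ i)) : GraphOfGroups.{u} (OrientedGraph.star ι) where
  vertexGroup := StarVertexGroup H L
  edgeGroup := A
  vertexGroup_group := starVertexGroupGroup H L
  toSrc := φ
  toTgt := ψ
  toSrc_injective := hφ
  toTgt_injective := hψ

/-- The morphism of star-shaped graphs of groups given by a homomorphism `q` of the central groups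
and by the identity maps of the edge groups and of the outer vertex groups. -/
def starHom {H' : Type u} [Group H'] {φ : ∀ i, A i →* H} {φ' : ∀ i, A i →* H'}
    {ψ : ∀ i, A i →* L i} (hφ : ∀ i, Function.Injective (φ i))
    (hφ' : ∀ i, Function.Injective (φ' i)) (hψ : ∀ i, Function.Injective (ψ i))
    (q : H →* H') (hq : ∀ i, q.comp (φ i) = φ' i) :
    Hom (star φ ψ hφ hψ) (star φ' ψ hφ' hψ) where
  onVertex
    | none => q
    | some i => MonoidHom.id (L i)
  onEdge i := MonoidHom.id (A i)
  comm_src i a := DFunLike.congr_fun (hq i) a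
  comm_tgt _ _ := rfl

end Star

end GraphOfGroups

/-- If `N` meets `K` trivially, then `K → H → H ⧸ N` is injective. -/
theorem injective_mk_comp_subtype {H : Type u} [Group H] (N : Subgroup H) [N.Normal]
    (K : Subgroup H) (h : N ⊓ K = ⊥) :
    Function.Injective ((QuotientGroup.mk' N).comp K.subtype) := by
  rw [injective_iff_map_eq_one]
  intro a ha
  have h1 : (a : H) ∈ N := by simpa using ha
  have h2 : (a : H) ∈ N ⊓ K := ⟨h1, a.2⟩
  rw [h] at h2
  exact Subtype.ext (Subgroup.mem_bot.1 h2)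

namespace GraphOfGroups

section StarQuotient

variable {ι : Type w} {H : Type u} [Group H] {L : ι → Type u} [∀ i, Group (L i)]
  {K : ι → Subgroup H}

/-- The star-shaped graph of groups with centre `H`, edge groups the subgroups `K i` of `H`, and
outer vertex groups `L i`, into which `K i` embeds by `ψ i`. -/
def subgroupStar (ψ : ∀ i, K i →* L i) (hψ : ∀ i, Function.Injective (ψ i)) :
    GraphOfGroups.{u} (OrientedGraph.star ι) :=
  star (fun i => (K i).subtype) ψ (fun i => (K i).subtype_injective) hψ

/-- The similar graph of groups in which the centre `H` is replaced by `H ⧸ N`. -/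
def quotientStar (N : Subgroup H) [N.Normal] (hN : ∀ i, N ⊓ K i = ⊥)
    (ψ : ∀ i, K i →* L i) (hψ : ∀ i, Function.Injective (ψ i)) :
    GraphOfGroups.{u} (OrientedGraph.star ι) :=
  star (fun i => (QuotientGroup.mk' N).comp (K i).subtype) ψ
    (fun i => injective_mk_comp_subtype N (K i) (hN i)) hψ

/-- The morphism given by the quotient map `H → H ⧸ N` at the centre and by the identity maps of
the edge groups and of the outer vertex groups. -/
def quotientStarHom (N : Subgroup H) [N.Normal] (hN : ∀ i, N ⊓ K i = ⊥)
    (ψ : ∀ i, K i →* L i) (hψ : ∀ i, Function.Injective (ψ i)) :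
    Hom (subgroupStar ψ hψ) (quotientStar N hN ψ hψ) :=
  starHom (fun i => (K i).subtype_injective)
    (fun i => injective_mk_comp_subtype N (K i) (hN i)) hψ (QuotientGroup.mk' N) (fun _ => rfl)

/-- The fundamental group of `subgroupStar`. -/
abbrev StarGroup (ψ : ∀ i, K i →* L i) (hψ : ∀ i, Function.Injective (ψ i)) : Type _ :=
  (subgroupStar ψ hψ).FundamentalGroup (OrientedGraph.starSpanningTree ι)

/-- The fundamental group of `quotientStar`. -/
abbrev QuotientStarGroup (N : Subgroup H) [N.Normal] (hN : ∀ i, N ⊓ K i = ⊥)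
    (ψ : ∀ i, K i →* L i) (hψ : ∀ i, Function.Injective (ψ i)) : Type _ :=
  (quotientStar N hN ψ hψ).FundamentalGroup (OrientedGraph.starSpanningTree ι)

/-- The homomorphism of fundamental groups induced by `quotientStarHom`. -/
def starGroupMap (N : Subgroup H) [N.Normal] (hN : ∀ i, N ⊓ K i = ⊥)
    (ψ : ∀ i, K i →* L i) (hψ : ∀ i, Function.Injective (ψ i)) :
    StarGroup ψ hψ →* QuotientStarGroup N hN ψ hψ :=
  (quotientStarHom N hN ψ hψ).map (OrientedGraph.starSpanningTree ι)

/-- The image of the central vertex group `H ⧸ N` in the fundamental group of `quotientStar`. -/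
def centralSubgroup (N : Subgroup H) [N.Normal] (hN : ∀ i, N ⊓ K i = ⊥)
    (ψ : ∀ i, K i →* L i) (hψ : ∀ i, Function.Injective (ψ i)) :
    Subgroup (QuotientStarGroup N hN ψ hψ) :=
  ((quotientStar N hN ψ hψ).ofVertex (OrientedGraph.starSpanningTree ι) none).range

end StarQuotient

end GraphOfGroups

/-! In Bass–Serre terms, the kernel acts on the tree of `G` with quotient the tree of `Q` (for
$\overline{G}$), with trivial edge stabilizers and copies of `N` at the central vertices, so it is
their free product `F`. The proof avoids trees and builds actions from the universal property of
amalgams (`IsStarAmalgam`).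

`G` acts on the set `F × Q` over left multiplication on `Q`, and `Q` acts on the set `G` over left
multiplication on `Q`. The `Q`-orbit of `1` is a set-theoretic section `p` of `π`, and `ρ : F → G`
sends the copies of `N` to conjugates of `N`. The map `(u, x) ↦ p x * ρ u` is `G`-equivariant, which
puts the kernel in the range of `ρ`; the orbit map of `G` at `(u, 1)` recovers `v * u` from `ρ v`,
so `ρ` is injective.

The actions glue because each edge group meets `N` trivially: it acts freely on `H ⧸ N`, so `H → H ⧸
N` has a section equivariant for it. Coset coordinates in `Q` need `H ⧸ N` to embed in `Q`
(`injective_center`). -/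

namespace MonoidHom

/-! ### Coset coordinates and free sets. -/

/-- For an injective homomorphism `j : A → B`, every `b : B` is the product of some `j (y b)` and
of the inverse of the representative of the left coset of `b⁻¹`. -/
theorem exists_coset_coordinate {A B : Type*} [Group A] [Group B] (j : A →* B)
    (hj : Function.Injective j) : ∃ y : B → A,
      (∀ b, j (y b) = b * Quotient.out ((b⁻¹ : B) : B ⧸ j.range)) ∧
      ∀ a b, y (j a * b) = a * y b := by
  have key : ∀ b : B, ∃ a : A, j a = b * Quotient.out ((b⁻¹ : B) : B ⧸ j.range) := by
    intro b
    have h : ((b⁻¹ : B) : B ⧸ j.range) =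
        ((Quotient.out ((b⁻¹ : B) : B ⧸ j.range) : B) : B ⧸ j.range) :=
      (QuotientGroup.out_eq' _).symm
    obtain ⟨a, ha⟩ := QuotientGroup.eq.1 h
    exact ⟨a, by simpa using ha⟩
  choose y hy using key
  refine ⟨y, hy, fun a b => hj ?_⟩
  have h : (((j a * b)⁻¹ : B) : B ⧸ j.range) = ((b⁻¹ : B) : B ⧸ j.range) :=
    QuotientGroup.eq.2 ⟨a, by simp⟩
  rw [hy, map_mul, hy, h, mul_assoc]

open Cardinal in
/-- For an injective homomorphism `A → B` and a sufficiently large set `X`, the free `A`-sets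
`B × X` and `A × X` are isomorphic. -/
theorem exists_equivariant_prod_equiv {A : Type u} {B : Type u} {X : Type v} [Group A] [Group B]
    (j : A →* B) (hj : Function.Injective j) [Infinite X]
    (hX : Cardinal.lift.{v} #B ≤ Cardinal.lift.{u} #X) :
    ∃ e : B × X ≃ A × X, ∀ a b x, e (j a * b, x) = (a * (e (b, x)).1, (e (b, x)).2) := by
  obtain ⟨y, -, hy⟩ := j.exists_coset_coordinate hj
  -- `R` is a transversal of the `A`-orbits, so `B ≃ A × R` equivariantly; `X` then absorbs `R`,
  -- being infinite and large enough.
  let R := {b : B // y b = 1}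
  have hinv : ∀ b, y ((j (y b))⁻¹ * b) = 1 := fun b => by rw [← map_inv, hy, inv_mul_cancel]
  let e₁ : B ≃ A × R :=
    { toFun := fun b => (y b, ⟨(j (y b))⁻¹ * b, hinv b⟩)
      invFun := fun q => j q.1 * q.2
      left_inv := fun b => by simp
      right_inv := by
        rintro ⟨a, b, hb⟩
        simp [hy, hb] }
  have : Nonempty R := ⟨⟨_, hinv 1⟩⟩
  have hR : Cardinal.lift.{v} #R ≤ Cardinal.lift.{u} #X :=
    (Cardinal.lift_le.2 (Cardinal.mk_subtype_le _)).trans hX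
  have hc : #(R × X) = Cardinal.lift.{u} #X := by
    rw [Cardinal.mk_prod]
    refine Cardinal.mul_eq_right ?_ hR ?_
    · simp
    · simp
  obtain ⟨e₂⟩ := Cardinal.lift_mk_eq'.1
    (show Cardinal.lift.{v} #(R × X) = Cardinal.lift.{max u v} #X by
      rw [hc]; simp)
  refine ⟨(e₁.prodCongr (Equiv.refl X)).trans
    ((Equiv.prodAssoc A R X).trans ((Equiv.refl A).prodCongr e₂)), fun a b x => ?_⟩
  simp [e₁, hy, mul_assoc]

end MonoidHom

/-! ### Amalgams of stars and the embedding of the centre. -/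

/-- Left multiplication on the first factor. -/
def mulLeftProdHom (B : Type u) (X : Type v) [Group B] : B →* Equiv.Perm (B × X) :=
  MonoidHom.toHomPerm
    { toFun := fun b => (fun z => (b * z.1, z.2) : B × X → B × X)
      map_one' := by funext z; simp; rfl
      map_mul' := fun b b' => by funext z; exact Prod.ext (mul_assoc _ _ _) rfl }

@[simp] theorem mulLeftProdHom_apply {B : Type u} {X : Type v} [Group B] (b : B) (z : B × X) :
    mulLeftProdHom B X b z = (b * z.1, z.2) := rfl

/-- `G` is the amalgam of the star of groups with centre `H`, edge groups `A i` and outer vertex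
groups `L i`, the homomorphisms of the vertex groups to `G` being `a` and `b i`. -/
structure IsStarAmalgam {ι : Type w} {H : Type u} [Group H] {A L : ι → Type u}
    [∀ i, Group (A i)] [∀ i, Group (L i)] (φ : ∀ i, A i →* H) (ψ : ∀ i, A i →* L i)
    {G : Type (max u w)} [Group G] (a : H →* G) (b : ∀ i, L i →* G) : Prop where
  comm : ∀ i x, a (φ i x) = b i (ψ i x)
  exists_lift : ∀ {P : Type (max u w)} [Group P] (f : H →* P) (g : ∀ i, L i →* P),
    (∀ i x, f (φ i x) = g i (ψ i x)) →
      ∃ k : G →* P, (∀ x, k (a x) = f x) ∧ ∀ i x, k (b i x) = g i x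
  eq_top : ∀ S : Subgroup G, (∀ x, a x ∈ S) → (∀ i x, b i x ∈ S) → S = ⊤

namespace IsStarAmalgam

variable {ι : Type w} {H : Type u} [Group H] {A L : ι → Type u}
  [∀ i, Group (A i)] [∀ i, Group (L i)] {φ : ∀ i, A i →* H} {ψ : ∀ i, A i →* L i}
  {G : Type (max u w)} [Group G] {a : H →* G} {b : ∀ i, L i →* G}

/-- A map between `G`-sets is equivariant if it is so for the vertex groups. -/
theorem equivariant (hG : IsStarAmalgam φ ψ a b) {Y Z : Type*} (α : G →* Equiv.Perm Y)
    (β : G →* Equiv.Perm Z) (f : Y → Z) (hH : ∀ x y, f (α (a x) y) = β (a x) (f y))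
    (hL : ∀ i x y, f (α (b i x) y) = β (b i x) (f y)) (g : G) (y : Y) :
    f (α g y) = β g (f y) := by
  let S : Subgroup G :=
    { carrier := {g | ∀ y, f (α g y) = β g (f y)}
      one_mem' := fun y => by simp
      mul_mem' := fun {g g'} h h' y => by
        simp only [Set.mem_ofPred_eq] at h h'
        simp [h, h']
      inv_mem' := fun {g} h y => by
        simp only [Set.mem_ofPred_eq] at h
        rw [map_inv, map_inv, Equiv.Perm.eq_inv_iff_eq, ← h, ← Equiv.Perm.mul_apply,
          mul_inv_cancel, Equiv.Perm.one_apply] }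
  have hS : S = ⊤ := hG.eq_top S hH hL
  exact (hS ▸ Subgroup.mem_top g : g ∈ S) y

open Cardinal in
/-- The central group of a star of groups embeds in the amalgam. -/
theorem injective_center (hG : IsStarAmalgam φ ψ a b) (hφ : ∀ i, Function.Injective (φ i))
    (hψ : ∀ i, Function.Injective (ψ i)) : Function.Injective a := by
  -- One set large enough for `H` and every `L i` at once; `ℕ` makes it infinite.
  let X : Type (max u w) := (H ⊕ (Σ i, L i)) ⊕ ℕ
  have hE : ∀ i, ∃ e : H × X ≃ L i × X, ∀ c z,
      e (mulLeftProdHom H X (φ i c) z) = mulLeftProdHom (L i) X (ψ i c) (e z) := by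
    intro i
    obtain ⟨e₁, h₁⟩ := (φ i).exists_equivariant_prod_equiv (X := X) (hφ i)
      (Cardinal.lift_mk_le_lift_mk_of_injective (f := fun h : H => (Sum.inl (Sum.inl h) : X))
        (Sum.inl_injective.comp Sum.inl_injective))
    obtain ⟨e₂, h₂⟩ := (ψ i).exists_equivariant_prod_equiv (X := X) (hψ i)
      (Cardinal.lift_mk_le_lift_mk_of_injective (f := fun l : L i => (Sum.inl (Sum.inr ⟨i, l⟩) : X))
        (Sum.inl_injective.comp (Sum.inr_injective.comp sigma_mk_injective)))
    refine ⟨e₁.trans e₂.symm, fun c z => ?_⟩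
    rw [Equiv.trans_apply, Equiv.symm_apply_eq, mulLeftProdHom_apply, mulLeftProdHom_apply, h₁, h₂]
    simp
  choose e he using hE
  -- Each `L i` acts on `H × X` by transport along `e i`, in agreement with `H` on the edge group.
  -- So `G` acts there, extending the free action of `H`.
  obtain ⟨k, hk, -⟩ := hG.exists_lift (mulLeftProdHom H X)
    (fun i => ((e i).symm.permCongrHom : _ →* Equiv.Perm (H × X)).comp (mulLeftProdHom (L i) X))
    (fun i c => by
      ext1 z
      simp only [MonoidHom.comp_apply, MonoidHom.coe_coe]
      exact ((e i).symm_apply_eq.2 (by rw [Equiv.symm_symm, he]; rfl)).symm)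
  intro h h' hh
  have := congrArg Prod.fst (Equiv.congr_fun ((hk h).symm.trans ((congrArg k hh).trans (hk h')))
    (1, Sum.inr 0))
  simpa using this

end IsStarAmalgam

/-! ### Actions given by cocycles. -/

/-- The action of `M` on `F × Q` over a homomorphism `k : M → Q` that is given by a cocycle `e`. -/
def cocycleHom {M Q F : Type*} [Group M] [Group Q] [Group F] (k : M →* Q) (e : M → Q → F)
    (he : ∀ m m' x, e (m * m') x = e m (k m' * x) * e m' x) : M →* Equiv.Perm (F × Q) :=
  MonoidHom.toHomPerm
    { toFun := fun m => (fun z => (e m z.2 * z.1, k m * z.2) : F × Q → F × Q)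
      map_one' := by
        funext z
        have h : e 1 z.2 = 1 := by simpa using he 1 1 z.2
        simp [h]
        rfl
      map_mul' := fun m m' => by
        funext z
        exact Prod.ext (by simp [he, mul_assoc]; rfl) (by simp [mul_assoc]; rfl) }

@[simp] theorem cocycleHom_apply {M Q F : Type*} [Group M] [Group Q] [Group F] (k : M →* Q)
    (e : M → Q → F) (he : ∀ m m' x, e (m * m') x = e m (k m' * x) * e m' x) (m : M) (z : F × Q) :
    cocycleHom k e he m z = (e m z.2 * z.1, k m * z.2) := rfl

/-- The action of `M` on a group `G` over `Q` that is given by a cocycle `e` lifting a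
homomorphism `k : M → Q`. -/
def liftedCocycleHom {M Q G : Type*} [Group M] [Group Q] [Group G] (π : G →* Q) (k : M →* Q)
    (e : M → Q → G) (hπ : ∀ m x, π (e m x) = k m)
    (he : ∀ m m' x, e (m * m') x = e m (k m' * x) * e m' x) : M →* Equiv.Perm G :=
  MonoidHom.toHomPerm
    { toFun := fun m => (fun z => e m (π z) * z : G → G)
      map_one' := by
        funext z
        have h : e 1 (π z) = 1 := by simpa using he 1 1 (π z)
        simp [h]
        rfl
      map_mul' := fun m m' => by
        funext z
        change e (m * m') (π z) * z = e m (π (e m' (π z) * z)) * (e m' (π z) * z)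
        simp [he, hπ, mul_assoc] }

@[simp] theorem liftedCocycleHom_apply {M Q G : Type*} [Group M] [Group Q] [Group G] (π : G →* Q)
    (k : M →* Q) (e : M → Q → G) (hπ : ∀ m x, π (e m x) = k m)
    (he : ∀ m m' x, e (m * m') x = e m (k m' * x) * e m' x) (m : M) (z : G) :
    liftedCocycleHom π k e hπ he m z = e m (π z) * z := rfl

/-- Left multiplication as a homomorphism to the permutations. -/
def mulLeftHom (G : Type*) [Group G] : G →* Equiv.Perm G := MulAction.toPermHom G G

@[simp] theorem mulLeftHom_apply {G : Type*} [Group G] (g z : G) : mulLeftHom G g z = g * z := rfl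

/-! ### The kernel as a free product. -/

namespace IsStarAmalgam

open Monoid

variable {ι : Type w} {H : Type u} [Group H] {A L : ι → Type u}
  [∀ i, Group (A i)] [∀ i, Group (L i)] {φ : ∀ i, A i →* H} {ψ : ∀ i, A i →* L i}
  {G : Type (max u w)} [Group G] {a : H →* G} {b : ∀ i, L i →* G}
  {N : Subgroup H} [N.Normal] {Q : Type (max u w)} [Group Q] {a' : H ⧸ N →* Q} {b' : ∀ i, L i →* Q}

/-- Replacing the centre `H` of a star of groups by its quotient by a normal subgroup that meets
the edge groups trivially divides the amalgam by a free product of copies of that subgroup. -/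
theorem nonempty_ker_mulEquiv (hG : IsStarAmalgam φ ψ a b)
    (hQ : IsStarAmalgam (fun i => (QuotientGroup.mk' N).comp (φ i)) ψ a' b')
    (hφ : ∀ i, Function.Injective ((QuotientGroup.mk' N).comp (φ i)))
    (hψ : ∀ i, Function.Injective (ψ i)) (π : G →* Q) (hπa : ∀ h : H, π (a h) = a' h)
    (hπb : ∀ i l, π (b i l) = b' i l) :
    Nonempty (π.ker ≃* CoprodI (fun _ : Q ⧸ a'.range => N)) := by
  obtain ⟨y, hy, hya⟩ := a'.exists_coset_coordinate (hQ.injective_center hφ hψ)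
  -- Inversion turns orbits of left multiplication by the centre into left cosets.
  let C : Q → Q ⧸ a'.range := fun x => ((x⁻¹ : Q) : Q ⧸ a'.range)
  have hC : ∀ h x, C (a' h * x) = C x := fun h x => QuotientGroup.eq.2 ⟨h, by simp⟩
  -- sections of the quotient map of the central groups
  obtain ⟨s, hs⟩ : ∃ s : H ⧸ N → H, ∀ q, (s q : H ⧸ N) = q := ⟨Quotient.out, QuotientGroup.out_eq'⟩
  have ht : ∀ i, ∃ t : H ⧸ N → H, (∀ q, (t q : H ⧸ N) = q) ∧
      ∀ c q, t ((φ i c : H) * q) = φ i c * t q := by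
    intro i
    obtain ⟨r, -, hr⟩ := ((QuotientGroup.mk' N).comp (φ i)).exists_coset_coordinate (hφ i)
    -- Apply `s` on the transversal where `r` is trivial and extend by translation by the edge
    -- group.
    refine ⟨fun q => φ i (r q) * s (((φ i (r q) : H) : H ⧸ N)⁻¹ * q), fun q => ?_, fun c q => ?_⟩
    · rw [QuotientGroup.mk_mul, hs, mul_inv_cancel_left]
    · have := hr c q
      simp only [MonoidHom.comp_apply, QuotientGroup.mk'_apply] at this
      simp only [this, map_mul, QuotientGroup.mk_mul, mul_inv_rev, mul_assoc, inv_mul_cancel_left]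
  choose t ht hta using ht
  -- the cocycles with values in the free product
  let κ : Q → N →* CoprodI (fun _ : Q ⧸ a'.range => N) := fun x => CoprodI.of (M := fun _ : Q ⧸ a'.range => N) (i := C x)
  have hκ : ∀ h x, κ (a' h * x) = κ x := fun h x => by simp only [κ, hC]
  have memN : ∀ {g : H}, (g : H ⧸ N) = 1 → g ∈ N := fun h => (QuotientGroup.eq_one_iff _).1 h
  -- `d` measures the failure of `s` to be equivariant. On the `i`-th edge group it is the
  -- coboundary of `f i`, since `t i` is equivariant there; that coboundary formula then extends to
  -- all of `L i`.
  let d : H → Q → N := fun h x => ⟨(s (h * y x))⁻¹ * h * s (y x), memN (by simp [hs])⟩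
  let f : ∀ i, Q → N := fun i x => ⟨(s (y x))⁻¹ * t i (y x), memN (by simp [hs, ht])⟩
  have hd : ∀ (h h' : H) x, d (h * h') x = d h (a' h' * x) * d h' x := fun h h' x => by
    ext; simp [d, hya, mul_assoc]
  have hdf : ∀ i c x, d (φ i c) x = f i (a' (φ i c : H) * x) * (f i x)⁻¹ := fun i c x => by
    ext; simp [d, f, hya, hta, mul_assoc]
  obtain ⟨α, hαa, hαb⟩ := hG.exists_lift
    (cocycleHom (a'.comp (QuotientGroup.mk' N)) (fun h x => κ x (d h x))
      (fun h h' x => by simp [hd, hκ]))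
    (fun i => cocycleHom (b' i) (fun l x => κ (b' i l * x) (f i (b' i l * x)) *
        (κ x (f i x))⁻¹)
      (fun l l' x => by simp [mul_assoc]))
    (fun i c => by
      have := hQ.comm i c
      simp only [MonoidHom.comp_apply, QuotientGroup.mk'_apply] at this
      ext1 z
      simp only [cocycleHom_apply, MonoidHom.comp_apply, QuotientGroup.mk'_apply, ← this, hdf,
        hκ, map_mul, map_inv])
  -- the action of `Q` on `G`
  let σ : Q → G := fun x => a (s (y x))
  let τ : ι → Q → G := fun i x => a (t i (y x))
  have hσ : ∀ x, π (σ x) = a' (y x) := fun x => by simp [σ, hπa, hs]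
  have hτ : ∀ i x, π (τ i x) = a' (y x) := fun i x => by simp [τ, hπa, ht]
  have hτa : ∀ i c x, τ i (a' (φ i c : H) * x) = a (φ i c) * τ i x := fun i c x => by
    simp [τ, hya, hta]
  have hf : ∀ i x, a (f i x) = (σ x)⁻¹ * τ i x := fun i x => by simp [f, σ, τ]
  have had : ∀ (h : H) x, a (d h x) = (σ (a' h * x))⁻¹ * a h * σ x := fun h x => by
    simp [d, σ, hya]
  obtain ⟨β, hβa, hβb⟩ := hQ.exists_lift
    (liftedCocycleHom π a' (fun h x => σ (a' h * x) * (σ x)⁻¹) (fun h x => by simp [hσ, hya])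
      (fun h h' x => by simp [mul_assoc]))
    (fun i => liftedCocycleHom π (b' i)
      (fun l x => σ (b' i l * x) * (τ i (b' i l * x))⁻¹ * b i l * τ i x * (σ x)⁻¹)
      (fun l x => by simp [hσ, hτ, hπb])
      (fun l l' x => by simp [mul_assoc]))
    (fun i c => by
      have h₁ := hQ.comm i c
      have h₂ := hG.comm i c
      simp only [MonoidHom.comp_apply, QuotientGroup.mk'_apply] at h₁
      ext1 z
      simp [← h₁, ← h₂, hτa, mul_assoc])
  let p : Q → G := fun x => β x 1
  -- The factor `σ` cancels the dependence of `p` on the position within an orbit of the centre, so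
  -- `e` descends to cosets and can define `ρ`.
  let e : Q → G := fun x => (σ x)⁻¹ * p x
  have hπβ : ∀ x z, π (β x z) = x * π z := fun x z =>
    hQ.equivariant β (mulLeftHom Q) π
      (fun h z => by
        obtain ⟨h, rfl⟩ := QuotientGroup.mk_surjective h
        simp [hβa, hσ, hya])
      (fun i l z => by simp [hβb, hσ, hτ, hπb]) x z
  have hπp : ∀ x, π (p x) = x := fun x => by simp [p, hπβ]
  have hpa : ∀ h x, p (a' h * x) = σ (a' h * x) * (σ x)⁻¹ * p x := fun h x => by
    have : p (a' h * x) = β (a' h) (p x) := by simp [p]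
    rw [this, hβa, liftedCocycleHom_apply, hπp]
  have hpb : ∀ i l x, p (b' i l * x) =
      σ (b' i l * x) * (τ i (b' i l * x))⁻¹ * b i l * τ i x * (σ x)⁻¹ * p x := fun i l x => by
    have : p (b' i l * x) = β (b' i l) (p x) := by simp [p]
    rw [this, hβb, liftedCocycleHom_apply, hπp]
  have hea : ∀ h x, e (a' h * x) = e x := fun h x => by simp [e, hpa, mul_assoc]
  -- the homomorphism from the free product to `G`
  let r : Q ⧸ a'.range → Q := fun c => (Quotient.out c)⁻¹
  have hr : ∀ x, a' (y x) * r (C x) = x := fun x => by simp [r, C, hy]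
  have hCr : ∀ c, C (r c) = c := fun c => by simp [C, r]
  have her : ∀ x, e (r (C x)) = e x := fun x => by
    conv_rhs => rw [← hr x, hea]
  let ρ : CoprodI (fun _ : Q ⧸ a'.range => N) →* G :=
    CoprodI.lift fun c => (MulAut.conj (e (r c))⁻¹).toMonoidHom.comp (a.comp N.subtype)
  have hρ : ∀ x n, ρ (κ x n) = (e x)⁻¹ * a n * e x := fun x n => by
    simp [ρ, κ, her]
  -- the equivariant maps between `G` and the product of the free product with `Q`
  have hΘ : ∀ g z, p (α g z).2 * ρ (α g z).1 = g * (p z.2 * ρ z.1) := fun g z =>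
    hG.equivariant α (mulLeftHom G) (fun z => p z.2 * ρ z.1)
      (fun h z => by
        simp [hαa, hρ, hpa, had, e, mul_assoc])
      (fun i l z => by
        simp [hαb, hρ, hpb, hf, e, mul_assoc]) g z
  have hα₂ : ∀ g z, (α g z).2 = π g * z.2 := fun g z =>
    hG.equivariant α ((mulLeftHom Q).comp π) Prod.snd
      (fun h z => by simp [hαa, hπa]) (fun i l z => by simp [hαb, hπb]) g z
  -- The next three facts say how the building blocks of `β` act through `α`: those from `σ` leave
  -- the free product coordinate alone, and those mixing `σ` and `τ` change it by `f`, which cancels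
  -- the coboundary on `L i`.
  have hασ : ∀ h x u, α (σ (a' h * x) * (σ x)⁻¹) (u, x) = (u, a' h * x) := fun h x u => by
    have h₁ : σ (a' h * x) * (σ x)⁻¹ = a (s (h * y x) * (s (y x))⁻¹) := by simp [σ, hya]
    have h₂ : d (s (h * y x) * (s (y x))⁻¹) x = 1 := by ext; simp [d, hs]
    rw [h₁, hαa, cocycleHom_apply]
    simp [h₂, hs]
  have hατ : ∀ i x u, α (τ i x * (σ x)⁻¹) (u, x) = (κ x (f i x) * u, x) := fun i x u => by
    have h₁ : τ i x * (σ x)⁻¹ = a (t i (y x) * (s (y x))⁻¹) := by simp [σ, τ]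
    have h₂ : d (t i (y x) * (s (y x))⁻¹) x = f i x := by ext; simp [d, f, hs, ht, mul_assoc]
    rw [h₁, hαa, cocycleHom_apply]
    simp [h₂, hs, ht]
  have hατ' : ∀ i x u, α (σ x * (τ i x)⁻¹) (u, x) = ((κ x (f i x))⁻¹ * u, x) := fun i x u => by
    have h₁ : σ x * (τ i x)⁻¹ = (τ i x * (σ x)⁻¹)⁻¹ := by simp
    rw [h₁, map_inv, Equiv.Perm.inv_eq_iff_eq, hατ, mul_inv_cancel_left]
  have hαz : ∀ v z, α z (v, 1) = ((α z (v, 1)).1, π z) := fun v z =>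
    Prod.ext rfl (by simp [hα₂])
  have hΦ : ∀ v x z, α (β x z) (v, 1) = ((α z (v, 1)).1, x * (α z (v, 1)).2) := fun v x z => by
    -- The trivial cocycle makes `Q` act on the second coordinate only.
    have := hQ.equivariant β (cocycleHom (MonoidHom.id Q)
        (fun _ _ => (1 : CoprodI (fun _ : Q ⧸ a'.range => N))) (by simp)) (fun z => α z (v, 1))
      (fun h z => by
        rw [hβa, liftedCocycleHom_apply, map_mul, Equiv.Perm.mul_apply, hαz, hασ]
        simp)
      (fun i l z => by
        rw [hβb, liftedCocycleHom_apply, map_mul, Equiv.Perm.mul_apply, hαz, mul_assoc _ (τ i _),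
          map_mul, Equiv.Perm.mul_apply, hατ, map_mul, Equiv.Perm.mul_apply, hαb,
          cocycleHom_apply, hατ']
        simp) x z
    simpa using this
  have hαp : ∀ v x, α (p x) (v, 1) = (v, x) := fun v x => by simp [p, hΦ]
  have hαρ : ∀ v u, α (ρ v) (u, 1) = (v * u, 1) := fun v u => by
    induction v using CoprodI.induction_on generalizing u with
    | one => simp
    | mul v w hv hw => simp [hv, hw, mul_assoc]
    | of c n =>
      have hc : CoprodI.of (M := fun _ : Q ⧸ a'.range => N) (i := c) n = κ (r c) n := by
        simp only [κ, hCr]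
      -- `p (r c)` carries `(u, 1)` to `(u, r c)`, the middle factor multiplies `u` by `n` in the
      -- copy at `c` and fixes `r c`, and the inverse of `p (r c)` carries the point back.
      have h₁ : ρ (κ (r c) n) =
          (p (r c))⁻¹ * (a (s (y (r c)) * n * (s (y (r c)))⁻¹) * p (r c)) := by
        simp [hρ, e, σ, mul_assoc]
      have hn : ((n : H) : H ⧸ N) = 1 := (QuotientGroup.eq_one_iff _).2 n.2
      have h₂ : d (s (y (r c)) * n * (s (y (r c)))⁻¹) (r c) = n := by
        ext; simp [d, hs, hn, mul_assoc]
      rw [hc, h₁, map_mul, Equiv.Perm.mul_apply, map_mul, Equiv.Perm.mul_apply, hαp, hαa,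
        cocycleHom_apply, map_inv, Equiv.Perm.inv_eq_iff_eq, hαp, h₂]
      simp [hs]
  have hinj : Function.Injective ρ := fun v w h => by
    have h₁ := hαρ v 1
    rw [h, hαρ] at h₁
    simpa using congrArg Prod.fst h₁.symm
  have hrange : ρ.range = π.ker := by
    apply le_antisymm
    · rw [CoprodI.range_eq_iSup, iSup_le_iff]
      rintro c _ ⟨n, rfl⟩
      have hn : ((n : H) : H ⧸ N) = 1 := (QuotientGroup.eq_one_iff _).2 n.2
      simp [MonoidHom.mem_ker, hπa, hn]
    · intro g hg
      have h₁ : π g = 1 := hg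
      -- As `p 1 = 1`, this writes `g` as `p (π g)` times a value of `ρ`; for `g` in the kernel only
      -- the latter remains.
      have h₂ := hΘ g (1, 1)
      rw [hα₂] at h₂
      exact ⟨(α g (1, 1)).1, by simpa [h₁, p] using h₂⟩
  exact ⟨((MonoidHom.ofInjective hinj).trans (MulEquiv.subgroupCongr hrange)).symm⟩

end IsStarAmalgam

/-! ### The fundamental group of a star is an amalgam. -/

namespace GraphOfGroups

section Star

variable {ι : Type w} {H : Type u} [Group H] {L : ι → Type u} [∀ i, Group (L i)]
  {A : ι → Type u} [∀ i, Group (A i)] (φ : ∀ i, A i →* H) (ψ : ∀ i, A i →* L i)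
  (hφ : ∀ i, Function.Injective (φ i)) (hψ : ∀ i, Function.Injective (ψ i))

/-- The central group inside the fundamental group of a star of groups. -/
def starCenter :
    H →* (star φ ψ hφ hψ).FundamentalGroup (OrientedGraph.starSpanningTree ι) :=
  (star φ ψ hφ hψ).ofVertex (OrientedGraph.starSpanningTree ι) none

/-- The outer vertex groups inside the fundamental group of a star of groups. -/
def starOuter (i : ι) :
    L i →* (star φ ψ hφ hψ).FundamentalGroup (OrientedGraph.starSpanningTree ι) :=
  (star φ ψ hφ hψ).ofVertex (OrientedGraph.starSpanningTree ι) (some i)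

/-- The homomorphisms of all the vertex groups of a star that are given by homomorphisms of the
central group and of the outer vertex groups. -/
def starVertexLift {P : Type*} [Group P] (f : H →* P) (g : ∀ i, L i →* P) :
    ∀ x, (star φ ψ hφ hψ).vertexGroup x →* P
  | none => f
  | some i => g i

/-- The homomorphism from the free product of the vertex groups and of the edge letters that is
given by homomorphisms of the vertex groups and kills the edge letters. -/
def starFreeProdLift {P : Type*} [Group P] (f : H →* P) (g : ∀ i, L i →* P) :
    (star φ ψ hφ hψ).FreeProd →* P :=
  Monoid.Coprod.lift (Monoid.CoprodI.lift (starVertexLift φ ψ hφ hψ f g)) 1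

theorem starFreeProdLift_vertexIn {P : Type*} [Group P] (f : H →* P) (g : ∀ i, L i →* P)
    (x : Option ι) (v : (star φ ψ hφ hψ).vertexGroup x) :
    starFreeProdLift φ ψ hφ hψ f g ((star φ ψ hφ hψ).vertexIn x v) =
      starVertexLift φ ψ hφ hψ f g x v := by
  simp [starFreeProdLift, vertexIn]

theorem starFreeProdLift_edgeIn {P : Type*} [Group P] (f : H →* P) (g : ∀ i, L i →* P) (i : ι) :
    starFreeProdLift φ ψ hφ hψ f g ((star φ ψ hφ hψ).edgeIn i) = 1 := by
  simp [starFreeProdLift, edgeIn]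

/-- The edge letters are trivial in the fundamental group of a star. -/
theorem star_ofEdge (i : ι) :
    (star φ ψ hφ hψ).ofEdge (OrientedGraph.starSpanningTree ι) i = 1 :=
  (QuotientGroup.eq_one_iff _).2 (Subgroup.subset_normalClosure (Or.inr ⟨i, Set.mem_univ i, rfl⟩))

/-- The fundamental group of a star of groups is the amalgam of its vertex groups. -/
theorem isStarAmalgam_star :
    IsStarAmalgam φ ψ (starCenter φ ψ hφ hψ) (starOuter φ ψ hφ hψ) where
  comm i x := by
    have h₂ := (QuotientGroup.eq_one_iff _).2
      (Subgroup.subset_normalClosure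
        (s := (star φ ψ hφ hψ).relators (OrientedGraph.starSpanningTree ι)) (Or.inl ⟨i, x, rfl⟩))
    have h₃ : (star φ ψ hφ hψ).ofEdge _ i * starOuter φ ψ hφ hψ i (ψ i x) *
        ((star φ ψ hφ hψ).ofEdge _ i)⁻¹ * (starCenter φ ψ hφ hψ (φ i x))⁻¹ = 1 := h₂
    rw [star_ofEdge, one_mul, inv_one, mul_one, mul_inv_eq_one] at h₃
    exact h₃.symm
  exists_lift {P} _ f g h := by
    refine ⟨QuotientGroup.lift _ (starFreeProdLift φ ψ hφ hψ f g) ?_, fun x => ?_, fun i x => ?_⟩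
    · refine Subgroup.normalClosure_le_normal (N := (starFreeProdLift φ ψ hφ hψ f g).ker) ?_
      rintro r (⟨i, x, rfl⟩ | ⟨i, -, rfl⟩)
      · rw [SetLike.mem_coe, MonoidHom.mem_ker, map_mul, map_mul, map_mul, map_inv, map_inv,
          starFreeProdLift_edgeIn, starFreeProdLift_vertexIn, starFreeProdLift_vertexIn, one_mul,
          inv_one, mul_one, mul_inv_eq_one]
        exact (h i x).symm
      · exact starFreeProdLift_edgeIn φ ψ hφ hψ f g i
    · exact starFreeProdLift_vertexIn φ ψ hφ hψ f g none x
    · exact starFreeProdLift_vertexIn φ ψ hφ hψ f g (some i) x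
  eq_top S hH hL := by
    let f : H →* S := (starCenter φ ψ hφ hψ).codRestrict S hH
    let g : ∀ i, L i →* S := fun i => (starOuter φ ψ hφ hψ i).codRestrict S (hL i)
    let k : (star φ ψ hφ hψ).FreeProd →* S := starFreeProdLift φ ψ hφ hψ f g
    -- The lift into `S`, followed by the inclusion, agrees with the quotient map on generators, so
    -- every class lies in `S`.
    have hk : S.subtype.comp k = QuotientGroup.mk' _ := by
      ext x v
      · refine (congrArg S.subtype (starFreeProdLift_vertexIn φ ψ hφ hψ f g x v)).trans ?_
        rcases x with _ | i <;> rfl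
      · exact (congrArg S.subtype (starFreeProdLift_edgeIn φ ψ hφ hψ f g x)).trans
          (star_ofEdge φ ψ hφ hψ x).symm
    rw [eq_top_iff]
    rintro v -
    obtain ⟨v, rfl⟩ := QuotientGroup.mk_surjective v
    have := DFunLike.congr_fun hk v
    simp only [MonoidHom.comp_apply, QuotientGroup.mk'_apply] at this
    rw [← this]
    exact (k v).2

end Star

end GraphOfGroups

theorem proposition4p2 (m : ℕ) (H : Type u) [Group H] (K : Fin m → Subgroup H)
    (N : Subgroup H) [N.Normal] (hN : ∀ i, N ⊓ K i = ⊥)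
    (L : Fin m → Type u) [∀ i, Group (L i)]
    (ψ : ∀ i, K i →* L i) (hψ : ∀ i, Function.Injective (ψ i)) :
    Function.Surjective (GraphOfGroups.starGroupMap N hN ψ hψ) ∧
      Nonempty ((GraphOfGroups.starGroupMap N hN ψ hψ).ker ≃*
        Monoid.CoprodI (fun _ : GraphOfGroups.QuotientStarGroup N hN ψ hψ ⧸
          GraphOfGroups.centralSubgroup N hN ψ hψ => N)) := by
  have hG := GraphOfGroups.isStarAmalgam_star (fun i => (K i).subtype) ψ
    (fun i => (K i).subtype_injective) hψ
  have hQ := GraphOfGroups.isStarAmalgam_star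
    (fun i => (QuotientGroup.mk' N).comp (K i).subtype) ψ
    (fun i => injective_mk_comp_subtype N (K i) (hN i)) hψ
  have hπ := (GraphOfGroups.quotientStarHom N hN ψ hψ).map_ofVertex
    (OrientedGraph.starSpanningTree (Fin m))
  refine ⟨?_, hG.nonempty_ker_mulEquiv hQ (fun i => injective_mk_comp_subtype N (K i) (hN i)) hψ
    (GraphOfGroups.starGroupMap N hN ψ hψ) (hπ none) (fun i => hπ (some i))⟩
  refine MonoidHom.range_eq_top.1 (hQ.eq_top _ (fun x => ?_) fun i l => ⟨_, hπ (some i) l⟩)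
  obtain ⟨h, rfl⟩ := QuotientGroup.mk_surjective x
  exact ⟨_, hπ none h⟩
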